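/- Conventions. $R$ is a commutative Noetherian ring of finite Krull dimension and $M$ is a finitely generated $R$-module. The (ordinal) length $\mathrm{len}(M)$ is the supremum of all ordinals $\alpha$ such that there is a strictly descending chain $(N_i)_{i<\alpha}$ of non-zero submodules of $M$; for modules of finite length it is the usual length. The valence of $M$ is the sum of the coefficients $a_i$ in the Cantor normal form $\mathrm{len}(M)=a_d\omega^d+\dots+a_1\omega+a_0$. The finitistic length of a module is the supremum of the lengths of its submodules of finite length, and the fundamental cycle of $M$ is the formal sum $\sum_{\mathfrak p} e_{\mathfrak p}\,[\mathfrak p]$ over the prime ideals of $R$, where $e_{\mathfrak p}$ is the finitistic length of the $R_{\mathfrak p}$-module $M_{\mathfrak p}$. The module $M$ is binary if every coefficient $e_{\mathfrak p}$ is $0$ or $1$. A submodule $N\subseteq M$ is open if $\mathrm{len}(N)=\mathrm{len}(M)$. Theorem. Let $M$ be a binary module of valence $v$. For an endomorphism $f\in\mathrm{End}_R(M)$ the following are equivalent: (i) $f$ is nilpotent; (ii) the kernel of $f$ is open; (iii) $f^v=0$. The set $\mathfrak N$ of all nilpotent endomorphisms of $M$ is a two-sided ideal of $\mathrm{End}_R(M)$,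 and it is a nilpotent ideal (that is, $\mathfrak N^k=0$ for some $k$) whenever $M$ has no $\mathbb Z$-torsion. Moreover, $\mathrm{End}_R(M)/\mathfrak N$ is commutative. -/

import Mathlib

open scoped Ordinal

universe u v

namespace OrdinalLength

/-- The ordinal length of the `R`-module `M`: the supremum of all ordinals `α` for which there is
a strictly descending chain, indexed by the ordinals below `α`, of nonzero submodules of `M`.
(The final zero submodule is not counted, so that a finite chain is measured by its number of
steps and the ordinal length of a module of finite length is the usual length.) -/
noncomputable def len (R : Type u) (M : Type v) [CommRing R] [AddCommGroup M] [Module R M] :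
    Ordinal.{v} :=
  sSup {α : Ordinal.{v} | ∃ c : Ordinal.{v} → Submodule R M,
    StrictAntiOn c (Set.Iio α) ∧ ∀ i < α, c i ≠ ⊥}

/-- The valence of an ordinal: the sum of the coefficients of its Cantor normal form
(all of which are smaller than `ω`). -/
noncomputable def ordinalValence (o : Ordinal.{v}) : ℕ :=
  ((Ordinal.CNF ω o).map fun p => Cardinal.toNat p.2.card).sum

/-- The valence of a module: the valence of its ordinal length. -/
noncomputable def valence (R : Type u) (M : Type v) [CommRing R] [AddCommGroup M] [Module R M] :
    ℕ :=
  ordinalValence (len R M)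

/-- A submodule is open if it has the same ordinal length as the ambient module. -/
def IsOpenSubmodule {R : Type u} {M : Type v} [CommRing R] [AddCommGroup M] [Module R M]
    (N : Submodule R M) : Prop :=
  len R N = len R M

/-- The finitistic length: the supremum of the lengths of the submodules of finite length. -/
noncomputable def finLen (R : Type u) (M : Type v) [CommRing R] [AddCommGroup M] [Module R M] :
    Ordinal.{v} :=
  sSup {α : Ordinal.{v} | ∃ N : Submodule R M, len R N = α ∧ α < ω}

/-- The coefficient at the prime `p` of the fundamental cycle of `M`: the finitistic length of the
localization of `M` at `p`. -/
noncomputable def fundamentalCycleCoeff (R : Type u) (M : Type v) [CommRing R] [AddCommGroup M]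
    [Module R M] (p : PrimeSpectrum R) : Ordinal.{max u v} :=
  finLen (Localization.AtPrime p.asIdeal) (LocalizedModule p.asIdeal.primeCompl M)

/-- A module is binary if every coefficient of its fundamental cycle is `0` or `1`. -/
def IsBinary (R : Type u) (M : Type v) [CommRing R] [AddCommGroup M] [Module R M] : Prop :=
  ∀ p : PrimeSpectrum R, fundamentalCycleCoeff R M p = 0 ∨ fundamentalCycleCoeff R M p = 1

end OrdinalLength

/-!
Endomorphisms of a binary module are controlled by its associated primes. Since every coefficient
of the fundamental cycle is at most `1`, the `p`-power torsion of `M_p` is the residue field `κ(p)`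
for each associated prime `p`, and zero for the other primes (`LocalTorsionSimple`, stated through
elements of `M`). Hence `End(M)` maps to the product of the fields `κ(p)`; the kernel of this ring
homomorphism, `locallyZeroIdeal`, is a two-sided ideal with commutative quotient, and it contains
the nilpotent endomorphisms.

Conversely, if `p` is minimal among the associated primes of a submodule `N`, then `N_p` is torsion,
so every `f` in the kernel vanishes on `N_p`, and `p` is not associated to the span of the images
`f(N)`. Applying the kernel repeatedly thus removes at least one associated prime each time
(`iterate_locallyZeroImage_eq_bot`): the kernel is a nilpotent ideal, with exponent the number of
associated primes.

What remains is that the length of a binary module is the natural sum of the ordinals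
`ω ^ dim (R / p)` over its associated primes (`len_eq_dimCoeff`): then the valence is the number of
associated primes, and a submodule is open exactly when it has all the associated primes of `M`.
For the lower bound, chains of length `ω ^ d` in `R / p` are built by induction on `d` from powers
of an element, and they are concatenated by increasing dimension from the bottom
(`hasChain_dimCoeff`). For the upper bound, the length is at most the rank of the poset of
submodules (`chainRank`), which is subadditive for the natural sum; the `p`-power torsion for a
maximal associated prime `p` has rank at most `ω ^ dim (R / p)`, because its proper quotients have
smaller dimension, and the quotient by it is again binary with fewer associated primes
(`chainRank_le_dimCoeff`).
-/

namespace OrdinalLength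

/-! ### Ordinals as polynomials in `ω` -/

/-- The ordinal whose Cantor normal form has the natural coefficients `f`. -/
noncomputable def ofCoeff (f : Ordinal.{v} →₀ ℕ) : Ordinal.{v} :=
  Ordinal.CNF.eval ω (f.mapRange (Nat.cast : ℕ → Ordinal) Nat.cast_zero)

lemma support_mapRange_natCast (f : Ordinal.{v} →₀ ℕ) :
    (f.mapRange (Nat.cast : ℕ → Ordinal.{v}) Nat.cast_zero).support = f.support :=
  Finsupp.support_mapRange_of_injective _ _ Nat.cast_injective

@[simp]
lemma ofCoeff_zero : ofCoeff (0 : Ordinal.{v} →₀ ℕ) = 0 := by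
  simp [ofCoeff]

lemma ofCoeff_add {f g : Ordinal.{v} →₀ ℕ}
    (h : ∀ a ∈ f.support, ∀ b ∈ g.support, b ≤ a) :
    ofCoeff (f + g) = ofCoeff f + ofCoeff g := by
  rw [ofCoeff, Finsupp.mapRange_add Nat.cast_add, Ordinal.CNF.eval_add]
  · rfl
  · simpa only [support_mapRange_natCast] using h

@[simp]
lemma ofCoeff_single (e : Ordinal.{v}) (n : ℕ) :
    ofCoeff (Finsupp.single e n) = ω ^ e * n := by
  simp [ofCoeff]

lemma ofCoeff_lt {f : Ordinal.{v} →₀ ℕ} {e : Ordinal.{v}} (h : ∀ a ∈ f.support, a < e) :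
    ofCoeff f < ω ^ e := by
  refine Ordinal.CNF.eval_lt (fun a => ?_) ?_
  · simp
  · simpa only [support_mapRange_natCast] using h

/-- The natural-number coefficients of the Cantor normal form. -/
noncomputable def natCoeff (o : Ordinal.{v}) : Ordinal.{v} →₀ ℕ :=
  (Ordinal.CNF.coeff ω o).mapRange (fun x => Cardinal.toNat x.card) (by simp)

lemma coeff_lt_omega (o e : Ordinal.{v}) : Ordinal.CNF.coeff ω o e < ω := by
  by_cases h : e ∈ (Ordinal.CNF ω o).map Prod.fst
  · obtain ⟨⟨a, c⟩, hm, rfl⟩ := List.mem_map.1 h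
    rw [Ordinal.CNF.coeff_of_mem_CNF hm]
    exact Ordinal.CNF.snd_lt Ordinal.one_lt_omega0 hm
  · rw [Ordinal.CNF.coeff_of_notMem_CNF h]
    exact Ordinal.omega0_pos

@[simp]
lemma ofCoeff_natCoeff (o : Ordinal.{v}) : ofCoeff (natCoeff o) = o := by
  conv_rhs => rw [← Ordinal.CNF.eval_coeff ω o]
  rw [ofCoeff]
  congr 1
  ext e
  obtain ⟨n, hn⟩ := Ordinal.lt_omega0.1 (coeff_lt_omega o e)
  simp [natCoeff, hn]

@[simp]
lemma natCoeff_ofCoeff (f : Ordinal.{v} →₀ ℕ) : natCoeff (ofCoeff f) = f := by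
  rw [natCoeff, ofCoeff]
  ext e
  rw [Finsupp.mapRange_apply, Ordinal.CNF.coeff_eval Ordinal.one_lt_omega0]
  · simp
  · intro e
    simp

lemma natCoeff_support_lt {o e : Ordinal.{v}} (h : o < ω ^ e) :
    ∀ a ∈ (natCoeff o).support, a < e := by
  intro a ha
  by_contra hlt
  rw [Finsupp.mem_support_iff] at ha
  apply ha
  rw [natCoeff, Finsupp.mapRange_apply, Ordinal.CNF.coeff_eq_zero_of_lt, Ordinal.card_zero,
    map_zero]
  exact h.trans_le (Ordinal.opow_le_opow_right Ordinal.omega0_pos (not_lt.1 hlt))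

/-- Ordinals are compared by the leading coefficient in which they differ. -/
lemma ofCoeff_lt_ofCoeff {f g : Ordinal.{v} →₀ ℕ} {e : Ordinal.{v}} (he : f e < g e)
    (h : ∀ a, e < a → f a = g a) : ofCoeff f < ofCoeff g := by
  classical
  have key : ∀ k : Ordinal.{v} →₀ ℕ, ofCoeff k = ofCoeff (k.filter (e < ·)) +
      (ω ^ e * (k e : Ordinal) + ofCoeff (k.filter (· < e))) := by
    intro k
    have hk : k = k.filter (e < ·) + (Finsupp.single e (k e) + k.filter (· < e)) := by
      ext a
      rcases lt_trichotomy a e with hlt | rfl | hlt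
      · simp [hlt, hlt.not_gt, hlt.ne']
      · simp
      · simp [hlt, hlt.not_gt, hlt.ne]
    conv_lhs => rw [hk]
    rw [ofCoeff_add, ofCoeff_add, ofCoeff_single]
    · intro a ha b hb
      have := Finset.mem_singleton.1 (Finsupp.support_single_subset ha)
      subst this
      simp only [Finsupp.support_filter, Finset.mem_filter] at hb
      exact hb.2.le
    · intro a ha b hb
      simp only [Finsupp.support_filter, Finset.mem_filter] at ha
      refine le_trans ?_ ha.2.le
      rcases Finset.mem_union.1 (Finsupp.support_add hb) with hb | hb
      · exact (Finset.mem_singleton.1 (Finsupp.support_single_subset hb)).le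
      · simp only [Finsupp.support_filter, Finset.mem_filter] at hb
        exact hb.2.le
  rw [key f, key g]
  have hfg : f.filter (e < ·) = g.filter (e < ·) := by
    ext a
    by_cases ha : e < a <;> simp [ha, h]
  rw [hfg]
  refine (add_lt_add_iff_left _).2 ?_
  calc ω ^ e * (f e : Ordinal) + ofCoeff (f.filter (· < e))
      < ω ^ e * (f e : Ordinal) + ω ^ e := by
        refine (add_lt_add_iff_left _).2 (ofCoeff_lt fun a ha => ?_)
        simp only [Finsupp.support_filter, Finset.mem_filter] at ha
        exact ha.2
    _ = ω ^ e * ((f e + 1 : ℕ) : Ordinal) := by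
        push_cast
        rw [mul_add_one]
    _ ≤ ω ^ e * (g e : Ordinal) := mul_le_mul_right (by exact_mod_cast he) _
    _ ≤ _ := le_self_add

lemma ofCoeff_lt_iff {f g : Ordinal.{v} →₀ ℕ} :
    ofCoeff f < ofCoeff g ↔ ∃ e, f e < g e ∧ ∀ a, e < a → f a = g a := by
  classical
  refine ⟨fun h => ?_, fun ⟨e, he, h⟩ => ofCoeff_lt_ofCoeff he h⟩
  have hne : (f.neLocus g).Nonempty := by
    rw [Finsupp.nonempty_neLocus_iff]
    rintro rfl
    exact h.false
  have hmax : ∀ a, (f.neLocus g).max' hne < a → f a = g a := by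
    intro a ha
    by_contra hfa
    exact (Finset.le_max' _ a (Finsupp.mem_neLocus.2 hfa)).not_gt ha
  refine ⟨_, lt_of_le_of_ne (not_lt.1 fun hlt => ?_)
    (Finsupp.mem_neLocus.1 (Finset.max'_mem _ hne)), hmax⟩
  exact h.not_gt (ofCoeff_lt_ofCoeff hlt fun a ha => (hmax a ha).symm)

/-- The natural (Hessenberg) sum: Cantor normal forms are added coefficientwise. -/
noncomputable def natSum (a b : Ordinal.{v}) : Ordinal.{v} :=
  ofCoeff (natCoeff a + natCoeff b)

lemma natSum_comm (a b : Ordinal.{v}) : natSum a b = natSum b a := by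
  rw [natSum, natSum, add_comm]

@[simp]
lemma natSum_ofCoeff (f g : Ordinal.{v} →₀ ℕ) :
    natSum (ofCoeff f) (ofCoeff g) = ofCoeff (f + g) := by
  simp [natSum]

lemma natSum_lt_natSum_left {a b : Ordinal.{v}} (h : a < b) (c : Ordinal.{v}) :
    natSum a c < natSum b c := by
  rw [← ofCoeff_natCoeff a, ← ofCoeff_natCoeff b, ofCoeff_lt_iff] at h
  obtain ⟨e, he, h⟩ := h
  exact ofCoeff_lt_iff.2 ⟨e, by simpa using he, fun a ha => by simp [h a ha]⟩

lemma natSum_lt_natSum_right {a b : Ordinal.{v}} (h : a < b) (c : Ordinal.{v}) :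
    natSum c a < natSum c b := by
  rw [natSum_comm c, natSum_comm c]
  exact natSum_lt_natSum_left h c

lemma natSum_le_natSum {a b c d : Ordinal.{v}} (h : a ≤ b) (h' : c ≤ d) :
    natSum a c ≤ natSum b d :=
  le_trans ((StrictMono.monotone fun _ _ h => natSum_lt_natSum_left h c) h)
    ((StrictMono.monotone fun _ _ h => natSum_lt_natSum_right h b) h')

lemma natSum_lt_omega0_opow {a b e : Ordinal.{v}} (ha : a < ω ^ e) (hb : b < ω ^ e) :
    natSum a b < ω ^ e := by
  classical
  refine ofCoeff_lt fun x hx => ?_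
  rcases Finset.mem_union.1 (Finsupp.support_add hx) with hx | hx
  · exact natCoeff_support_lt ha x hx
  · exact natCoeff_support_lt hb x hx

lemma ordinalValence_ofCoeff (f : Ordinal.{v} →₀ ℕ) :
    ordinalValence (ofCoeff f) = f.sum fun _ n => n := by
  induction f using Finsupp.induction_on_max with
  | zero => simp [ordinalValence]
  | single_add e n f hf hn IH =>
    rw [ofCoeff_add, ofCoeff_single, ordinalValence, Ordinal.CNF.opow_mul_add
      Ordinal.one_lt_omega0 (by exact_mod_cast hn) (by simp) (ofCoeff_lt hf)]
    · rw [Finsupp.sum_add_index' (by simp) (by simp), ← IH, ordinalValence]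
      simp
    · intro a ha b hb
      rw [Finset.mem_singleton.1 (Finsupp.support_single_subset ha)]
      exact (hf b hb).le

lemma ofCoeff_strictMono : StrictMono (ofCoeff : (Ordinal.{v} →₀ ℕ) → Ordinal.{v}) := by
  intro f g hfg
  have hne : ofCoeff (g - f) ≠ 0 := by
    intro h0
    have := congrArg natCoeff (h0.trans ofCoeff_zero.symm)
    rw [natCoeff_ofCoeff, natCoeff_ofCoeff] at this
    exact hfg.not_ge (tsub_eq_zero_iff_le.1 this)
  have h := natSum_lt_natSum_right (pos_iff_ne_zero.2 hne) (ofCoeff f)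
  rwa [← ofCoeff_zero, natSum_ofCoeff, natSum_ofCoeff, add_zero,
    add_tsub_cancel_of_le hfg.le] at h

/-! ### Transfinite descending chains and ranks -/

section Chain

universe w

variable {X : Type v} [PartialOrder X]

/-- There is a strictly descending chain indexed by the ordinals below `α` in the half-open
interval `(a, b]`. -/
def HasChain (a b : X) (α : Ordinal.{w}) : Prop :=
  ∃ c : Ordinal.{w} → X, StrictAntiOn c (Set.Iio α) ∧ ∀ i < α, a < c i ∧ c i ≤ b

lemma HasChain.mono {a a' b b' : X} {α : Ordinal.{w}} (h : HasChain a b α) (ha : a' ≤ a)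
    (hb : b ≤ b') : HasChain a' b' α := by
  obtain ⟨c, hc, h⟩ := h
  exact ⟨c, hc, fun i hi => ⟨ha.trans_lt (h i hi).1, (h i hi).2.trans hb⟩⟩

lemma hasChain_zero (a b : X) : HasChain a b (0 : Ordinal.{w}) :=
  ⟨fun _ => a, fun i hi => absurd hi (not_lt_zero (a := i)),
    fun i hi => absurd hi (not_lt_zero (a := i))⟩

lemma hasChain_one {a b : X} (h : a < b) : HasChain a b (1 : Ordinal.{w}) := by
  refine ⟨fun _ => b, fun i hi j hj hij => ?_, fun i _ => ⟨h, le_rfl⟩⟩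
  rw [Set.mem_Iio, Order.lt_one_iff] at hi hj
  exact absurd hij (by simp [hi, hj])

/-- The upper chain comes first, as chains descend. -/
lemma HasChain.add {a b c : X} {α β : Ordinal.{w}} (hα : HasChain b c α) (hβ : HasChain a b β)
    (hab : a ≤ b) (hbc : b ≤ c) : HasChain a c (α + β) := by
  classical
  obtain ⟨f, hf, hf'⟩ := hα
  obtain ⟨g, hg, hg'⟩ := hβ
  have hsub : ∀ i, i < α + β → ¬ i < α → i - α < β := fun i hi h =>
    (Ordinal.sub_lt_of_le (not_lt.1 h)).2 hi
  refine ⟨fun i => if i < α then f i else g (i - α), fun i hi j hj hij => ?_, fun i hi => ?_⟩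
  · dsimp only
    by_cases hj' : j < α
    · rw [if_pos hj', if_pos (hij.trans hj')]
      exact hf (hij.trans hj') hj' hij
    · rw [if_neg hj']
      by_cases hi' : i < α
      · rw [if_pos hi']
        exact (hg' _ (hsub j hj hj')).2.trans_lt (hf' i hi').1
      · rw [if_neg hi']
        refine hg (hsub i hi hi') (hsub j hj hj') ?_
        rwa [← add_lt_add_iff_left α, Ordinal.add_sub_cancel_of_le (not_lt.1 hi'),
          Ordinal.add_sub_cancel_of_le (not_lt.1 hj')]
  · dsimp only
    split_ifs with h
    · exact ⟨hab.trans_lt (hf' i h).1, (hf' i h).2⟩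
    · exact ⟨(hg' _ (hsub i hi h)).1, (hg' _ (hsub i hi h)).2.trans hbc⟩

/-- Countably many chains of length `β`, each below the previous one, form a chain of length
`β * ω`. -/
lemma HasChain.mul_omega0 {a : X} {b : ℕ → X} {β : Ordinal.{w}} (hb : Antitone b)
    (ha : ∀ n, a ≤ b n) (h : ∀ n, HasChain (b (n + 1)) (b n) β) : HasChain a (b 0) (β * ω) := by
  rcases eq_or_ne β 0 with rfl | hβ
  · rw [zero_mul]
    exact hasChain_zero _ _
  choose c hc hc' using h
  have hdiv : ∀ i < β * ω, ∃ n : ℕ, i / β = n := fun i hi =>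
    Ordinal.lt_omega0.1 ((Ordinal.lt_mul_iff_div_lt hβ).1 hi)
  have hmod : ∀ i : Ordinal.{w}, i % β < β := fun i => Ordinal.mod_lt i hβ
  refine ⟨fun i => c (Cardinal.toNat (i / β).card) (i % β), fun i hi j hj hij => ?_,
    fun i hi => ?_⟩
  · obtain ⟨n, hn⟩ := hdiv i hi
    obtain ⟨m, hm⟩ := hdiv j hj
    have hnm : n ≤ m := by
      have : i / β ≤ j / β := Ordinal.div_le_left hij.le β
      rw [hn, hm] at this
      exact_mod_cast this
    simp only [hn, hm, Ordinal.card_nat, Cardinal.toNat_natCast]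
    rcases hnm.eq_or_lt with rfl | hlt
    · refine hc n (hmod i) (hmod j) ?_
      rwa [← Ordinal.div_add_mod i β, ← Ordinal.div_add_mod j β, hn, hm,
        add_lt_add_iff_left] at hij
    · exact ((hc' m _ (hmod j)).2.trans (hb hlt)).trans_lt (hc' n _ (hmod i)).1
  · obtain ⟨n, hn⟩ := hdiv i hi
    simp only [hn, Ordinal.card_nat, Cardinal.toNat_natCast]
    exact ⟨(ha _).trans_lt (hc' n _ (hmod i)).1, (hc' n _ (hmod i)).2.trans (hb n.zero_le)⟩

variable [WellFoundedGT X]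

/-- The rank of `a` is the least strictly decreasing ordinal-valued function on the elements
above `a`. -/
lemma rank_le_of_strictAnti {a : X} (φ : X → Ordinal.{v})
    (h : ∀ x y, a ≤ x → x < y → φ y < φ x) :
    IsWellFounded.rank (α := X) (· > ·) a ≤ φ a := by
  induction a using WellFoundedGT.induction with
  | ind a IH =>
    rw [IsWellFounded.rank_eq]
    refine Ordinal.iSup_le fun ⟨b, hb⟩ => Order.succ_le_of_lt ?_
    exact (IH b hb fun x y hx => h x y (hb.le.trans hx)).trans_lt (h a b le_rfl hb)

lemma HasChain.le_rank {a b : X} {α : Ordinal.{v}} (h : HasChain a b α) :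
    α ≤ IsWellFounded.rank (α := X) (· > ·) a := by
  obtain ⟨c, hc, hc'⟩ := h
  have key : ∀ i, i < α → i ≤ IsWellFounded.rank (α := X) (· > ·) (c i) := by
    intro i
    induction i using WellFoundedLT.induction with
    | ind i IH =>
      intro hi
      refine le_of_forall_lt fun j hj => ?_
      exact (IH j hj (hj.trans hi)).trans_lt
        (WellFoundedGT.rank_strictAnti (hc (hj.trans hi) hi hj))
  exact le_of_forall_lt fun i hi =>
    (key i hi).trans_lt (WellFoundedGT.rank_strictAnti (hc' i hi).1)

end Chain

section Rank

variable (R : Type u) (M : Type v) [CommRing R] [AddCommGroup M] [Module R M]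

/-- The rank of the zero submodule in the poset of submodules ordered by reverse inclusion. -/
noncomputable def chainRank [IsNoetherian R M] : Ordinal.{v} :=
  IsWellFounded.rank (α := Submodule R M) (· > ·) ⊥

variable {R M}

lemma rank_le_chainRank_quotient [IsNoetherian R M] (N : Submodule R M) :
    IsWellFounded.rank (α := Submodule R M) (· > ·) N ≤ chainRank R (M ⧸ N) := by
  have h := rank_le_of_strictAnti (X := Submodule R M) (a := N)
    (fun x => IsWellFounded.rank (α := Submodule R (M ⧸ N)) (· > ·) (x.map N.mkQ)) ?_
  · refine h.trans_eq ?_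
    rw [chainRank, Submodule.mkQ_map_self]
  · intro x y hx hxy
    refine WellFoundedGT.rank_strictAnti (lt_of_le_of_ne (Submodule.map_mono hxy.le) fun he => ?_)
    have := congrArg (Submodule.comap N.mkQ) he
    rw [Submodule.comap_map_mkQ, Submodule.comap_map_mkQ, sup_eq_right.2 hx,
      sup_eq_right.2 (hx.trans hxy.le)] at this
    exact hxy.ne this

/-- Subadditivity of the rank, with respect to the natural sum. -/
lemma chainRank_le_natSum {M₁ M₂ M₃ : Type v} [AddCommGroup M₁] [AddCommGroup M₂]
    [AddCommGroup M₃] [Module R M₁] [Module R M₂] [Module R M₃] [IsNoetherian R M₁]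
    [IsNoetherian R M₂] [IsNoetherian R M₃] {f : M₁ →ₗ[R] M₂} {g : M₂ →ₗ[R] M₃}
    (h : Function.Exact f g) :
    chainRank R M₂ ≤ natSum (chainRank R M₁) (chainRank R M₃) := by
  have key := rank_le_of_strictAnti (X := Submodule R M₂) (a := ⊥)
    (fun x => natSum (IsWellFounded.rank (α := Submodule R M₁) (· > ·) (x.comap f))
      (IsWellFounded.rank (α := Submodule R M₃) (· > ·) (x.map g))) ?_
  · refine key.trans ?_
    rw [chainRank, chainRank, Submodule.map_bot]
    refine natSum_le_natSum ?_ le_rfl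
    exact WellFoundedGT.rank_strictAnti.antitone bot_le
  · intro x y _ hxy
    have h1 : x.comap f ≤ y.comap f := Submodule.comap_mono hxy.le
    have h2 : x.map g ≤ y.map g := Submodule.map_mono hxy.le
    rcases h1.eq_or_lt with he | hlt
    · have hne : x.map g ≠ y.map g := by
        intro he'
        refine hxy.not_ge fun z hz => ?_
        have : g z ∈ x.map g := he' ▸ Submodule.mem_map_of_mem hz
        obtain ⟨w, hw, hwz⟩ := this
        obtain ⟨t, ht⟩ := (h (z - w)).1 (by rw [map_sub, hwz, sub_self])
        have hty : t ∈ y.comap f := by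
          rw [Submodule.mem_comap, ht]
          exact y.sub_mem hz (hxy.le hw)
        rw [← he, Submodule.mem_comap, ht] at hty
        simpa using x.add_mem hty hw
      rw [he]
      exact natSum_lt_natSum_right (WellFoundedGT.rank_strictAnti (h2.lt_of_ne hne)) _
    · exact (natSum_lt_natSum_left (WellFoundedGT.rank_strictAnti hlt) _).trans_le
        (natSum_le_natSum le_rfl (WellFoundedGT.rank_strictAnti.antitone h2))

lemma mem_len_iff {α : Ordinal.{v}} :
    (∃ c : Ordinal.{v} → Submodule R M, StrictAntiOn c (Set.Iio α) ∧ ∀ i < α, c i ≠ ⊥) ↔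
      HasChain (⊥ : Submodule R M) ⊤ α := by
  simp [HasChain, bot_lt_iff_ne_bot]

/-- Each term of a descending chain has rank at least its index. -/
lemma len_le_chainRank [IsNoetherian R M] : len R M ≤ chainRank R M :=
  csSup_le' fun _ hα => (mem_len_iff.1 hα).le_rank

lemma HasChain.le_len [IsNoetherian R M] {α : Ordinal.{v}}
    (h : HasChain (⊥ : Submodule R M) ⊤ α) : α ≤ len R M :=
  le_csSup ⟨chainRank R M, fun _ hα => (mem_len_iff.1 hα).le_rank⟩ (mem_len_iff.2 h)

end Rank

/-! ### Lengths and dimensions of primes -/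

section Dimension

universe w

variable {R : Type u} {M : Type v} [CommRing R] [AddCommGroup M] [Module R M]

/-- A cyclic subquotient whose annihilator lies below a prime of coheight at least `d` has a
chain of length `ω ^ d`. If `x` lies in a larger prime `q` but not in `p`, the multiples of
`x ^ n • m` filter the subquotient by pieces whose annihilators lie below `q`. -/
lemma hasChain_omega0_opow (d : ℕ) (p : PrimeSpectrum R) (hd : (d : ℕ∞) ≤ Order.coheight p)
    (a : Submodule R M) (m : M) (hm : ∀ r : R, r • m ∈ a → r ∈ p.asIdeal) :
    HasChain a (a ⊔ Submodule.span R {m}) (ω ^ (d : Ordinal.{w})) := by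
  induction d generalizing p a m with
  | zero =>
    rw [Nat.cast_zero, Ordinal.opow_zero]
    refine hasChain_one (lt_of_le_of_ne le_sup_left fun he => ?_)
    refine (Ideal.ne_top_iff_one _).1 p.2.ne_top (hm 1 ?_)
    rw [one_smul, he]
    exact Submodule.mem_sup_right (Submodule.mem_span_singleton_self m)
  | succ d IH =>
    obtain ⟨q, hpq, hq⟩ : ∃ q > p, (d : ℕ∞) ≤ Order.coheight q := by
      by_contra! hcon
      have := hd.trans (Order.coheight_le_coe_iff.2 hcon)
      exact absurd (ENat.natCast_le_natCast.1 this) (by simp)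
    obtain ⟨x, hxq, hxp⟩ := SetLike.exists_of_lt (show p.asIdeal < q.asIdeal from hpq)
    -- Enlarging `a` makes the annihilator of `m` modulo `a'` equal to `p`.
    let a' : Submodule R M := a ⊔ Submodule.map (LinearMap.toSpanSingleton R M m) p.asIdeal
    have ha' : ∀ r : R, r • m ∈ a' → r ∈ p.asIdeal := by
      intro r hr
      obtain ⟨u, hu, w, ⟨s, hs, rfl⟩, huw⟩ := Submodule.mem_sup.1 hr
      have : (r - s) • m ∈ a := by
        rw [sub_smul, ← huw, LinearMap.toSpanSingleton_apply, add_sub_cancel_right]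
        exact hu
      simpa using p.asIdeal.add_mem (hm _ this) hs
    let b : ℕ → Submodule R M := fun n => a' ⊔ Submodule.span R {x ^ n • m}
    have hb : Antitone b := by
      refine antitone_nat_of_succ_le fun n => sup_le_sup_left ?_ _
      rw [Submodule.span_singleton_le_iff_mem, pow_succ', mul_smul]
      exact Submodule.smul_mem _ _ (Submodule.mem_span_singleton_self _)
    have hchain : ∀ n, HasChain (b (n + 1)) (b n) (ω ^ (d : Ordinal.{w})) := by
      intro n
      refine (IH q hq (b (n + 1)) (x ^ n • m) fun r hr => ?_).mono le_rfl
        (sup_le (hb n.le_succ) le_sup_right)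
      obtain ⟨u, hu, w, hw, huw⟩ := Submodule.mem_sup.1 hr
      obtain ⟨s, rfl⟩ := Submodule.mem_span_singleton.1 hw
      have hmem : (x ^ n * (r - s * x)) • m ∈ a' := by
        have : (x ^ n * (r - s * x)) • m = u := by
          rw [eq_sub_of_add_eq huw]
          simp only [smul_smul, ← sub_smul]
          ring_nf
        rwa [this]
      have h1 := (p.2.mem_or_mem (ha' _ hmem)).resolve_left
        fun h => hxp (p.2.mem_of_pow_mem n h)
      have h2 := q.asIdeal.add_mem (hpq.le h1) (q.asIdeal.mul_mem_left s hxq)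
      simpa using h2
    have := HasChain.mul_omega0 hb (fun n => le_sup_left) hchain
    rw [Nat.cast_succ, ← Order.succ_eq_add_one, Ordinal.opow_succ]
    refine this.mono le_sup_left (sup_le (sup_le le_sup_left ?_) ?_)
    · rintro _ ⟨s, -, rfl⟩
      exact Submodule.mem_sup_right (Submodule.smul_mem _ _ (Submodule.mem_span_singleton_self m))
    · rw [pow_zero, one_smul]
      exact le_sup_right

/-- The dimension of the quotient by a prime, as a natural number (junk value `0` if infinite). -/
noncomputable def primeDim (p : PrimeSpectrum R) : ℕ :=
  (Order.coheight p).toNat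

/-- The Cantor normal form coefficients of the natural sum of the `ω ^ dim (R / p)` for `p` in a
finite set of primes. -/
noncomputable def dimCoeff (S : Finset (PrimeSpectrum R)) : Ordinal.{w} →₀ ℕ :=
  ∑ p ∈ S, Finsupp.single (primeDim p : Ordinal.{w}) 1

lemma mem_support_dimCoeff {S : Finset (PrimeSpectrum R)} {e : Ordinal.{w}}
    (he : e ∈ (dimCoeff S).support) : ∃ p ∈ S, e = primeDim p := by
  classical
  obtain ⟨p, hp, h⟩ := Finset.mem_biUnion.1 (Finsupp.support_finsetSum he)
  exact ⟨p, hp, Finset.mem_singleton.1 (Finsupp.support_single_subset h)⟩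

/-- A finite set of associated primes of a quotient contributes its natural sum to the length.
The primes of smallest dimension are used at the bottom of the chain, so that the natural sum is
an ordinary sum. -/
lemma hasChain_dimCoeff (S : Finset (PrimeSpectrum R)) (a : Submodule R M)
    (hS : ∀ p ∈ S, ∃ m : M, ∀ r : R, r • m ∈ a ↔ r ∈ p.asIdeal) :
    HasChain a ⊤ (ofCoeff (dimCoeff.{u, w} S)) := by
  classical
  revert a hS
  refine Finset.induction_on_min_value primeDim S ?_ ?_
  · intro a _
    simpa [dimCoeff] using hasChain_zero _ _
  · intro p S hpS hmin IH a hS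
    obtain ⟨m, hm⟩ := hS p (Finset.mem_insert_self _ _)
    have hlow := hasChain_omega0_opow.{u, v, w} (primeDim p) p (ENat.natCast_toNat_le_self _) a m
      fun r => (hm r).1
    have hup := IH (a ⊔ Submodule.span R {m}) fun q hq => by
      obtain ⟨y, hy⟩ := hS q (Finset.mem_insert_of_mem hq)
      refine ⟨y, fun r => ⟨fun hr => ?_, fun hr => Submodule.mem_sup_left ((hy r).2 hr)⟩⟩
      by_contra hrq
      obtain ⟨u, hu, w, hw, huw⟩ := Submodule.mem_sup.1 hr
      obtain ⟨s, rfl⟩ := Submodule.mem_span_singleton.1 hw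
      -- Modulo `a`, the elements `r • y` and `s • m` agree, but have different annihilators.
      have hiff : ∀ t : R, (t * r) • y ∈ a ↔ (t * s) • m ∈ a := by
        intro t
        rw [mul_smul, ← huw, smul_add, mul_smul]
        exact Submodule.add_mem_iff_right _ (a.smul_mem t hu)
      have hsp : s ∉ p.asIdeal := by
        intro hs
        have := (hiff 1).2 ((hm _).2 (by simpa using hs))
        exact hrq (by simpa using (hy _).1 this)
      apply hpS
      suffices p = q by rwa [this]
      ext t
      have := hiff t
      rw [hy, hm, q.2.mul_mem_iff_mem_or_mem, p.2.mul_mem_iff_mem_or_mem] at this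
      tauto
    have := hup.add hlow le_sup_left le_top
    rw [dimCoeff, Finset.sum_insert hpS, add_comm, ofCoeff_add]
    · simpa [dimCoeff] using this
    · intro e he e' he'
      obtain ⟨q, hq, rfl⟩ := mem_support_dimCoeff he
      rw [Finset.mem_singleton.1 (Finsupp.support_single_subset he')]
      exact_mod_cast hmin q hq

lemma chainRank_le_of_quotient [IsNoetherian R M] {o : Ordinal.{v}}
    (h : ∀ x : Submodule R M, x ≠ ⊥ → chainRank R (M ⧸ x) < o) : chainRank R M ≤ o := by
  rw [chainRank, IsWellFounded.rank_eq]
  refine Ordinal.iSup_le fun ⟨x, hx⟩ => Order.succ_le_of_lt ?_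
  exact (rank_le_chainRank_quotient x).trans_lt (h x (ne_bot_of_gt hx))

lemma chainRank_eq_zero [Subsingleton M] : chainRank R M = 0 := by
  rw [chainRank, IsWellFounded.rank_eq]
  refine le_antisymm (Ordinal.iSup_le fun ⟨x, hx⟩ => ?_) zero_le
  exact absurd (Subsingleton.elim x ⊥) (ne_bot_of_gt hx)

variable [IsNoetherianRing R]

/-- A module of dimension less than `d` has rank less than `ω ^ d`, by a prime filtration: the proper
quotients of `R / p` have smaller dimension. -/
lemma chainRank_lt_omega0_opow (d : ℕ) (M : Type v) [AddCommGroup M] [Module R M]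
    [Module.Finite R M] (h : ∀ q ∈ Module.support R M, Order.coheight q < d) :
    chainRank R M < ω ^ (d : Ordinal.{v}) := by
  induction d generalizing M with
  | zero =>
    have : Subsingleton M := by
      rw [← Module.support_eq_empty_iff (R := R), Set.eq_empty_iff_forall_notMem]
      exact fun q hq => by simpa using h q hq
    rw [chainRank_eq_zero]
    simp
  | succ d IH =>
    revert h
    induction ‹Module.Finite R M› using
      IsNoetherianRing.induction_on_isQuotientEquivQuotientPrime R with
    | subsingleton N =>
      intro _
      rw [chainRank_eq_zero]
      exact Ordinal.opow_pos _ Ordinal.omega0_pos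
    | quotient N p f =>
      intro h
      refine (chainRank_le_of_quotient (o := ω ^ (d : Ordinal)) fun x hx => ?_).trans_lt
        ((Ordinal.opow_lt_opow_iff_right Ordinal.one_lt_omega0).2 (by simp))
      have hsupp : ∀ q : PrimeSpectrum R, q ∈ Module.support R N ↔ p ≤ q := by
        intro q
        rw [f.support_eq, Module.support_eq_zeroLocus, Ideal.annihilator_quotient,
          PrimeSpectrum.mem_zeroLocus]
        rfl
      refine IH _ fun q hq => ?_
      have hpq : p ≤ q := (hsupp q).1
        (Module.support_subset_of_surjective x.mkQ x.mkQ_surjective hq)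
      have hne : p ≠ q := by
        rintro rfl
        rw [Module.mem_support_iff_exists_annihilator] at hq
        obtain ⟨z, hz⟩ := hq
        obtain ⟨z, rfl⟩ := x.mkQ_surjective z
        obtain ⟨y, hyx, hy0⟩ := x.exists_mem_ne_zero_of_ne_bot hx
        obtain ⟨s, hs⟩ := Ideal.Quotient.mk_surjective (f y)
        obtain ⟨t, ht⟩ := Ideal.Quotient.mk_surjective (f z)
        have hsp : s ∉ p.asIdeal := by
          intro hsp
          rw [Ideal.Quotient.eq_zero_iff_mem.2 hsp] at hs
          exact hy0 (f.injective (by rw [← hs, map_zero]))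
        refine hsp (hz ?_)
        rw [Submodule.mem_annihilator_span_singleton, ← map_smul, Submodule.mkQ_apply,
          Submodule.Quotient.mk_eq_zero]
        have : s • z = t • y := by
          apply f.injective
          rw [map_smul, map_smul, ← hs, ← ht, Algebra.smul_def, Algebra.smul_def]
          exact mul_comm _ _
        rw [this]
        exact x.smul_mem t hyx
      have h1 := h p ((hsupp p).2 le_rfl)
      have h2 := Order.coheight_add_one_le (lt_of_le_of_ne hpq hne)
      push_cast at h1
      have h3 : Order.coheight p ≤ d := Order.le_of_lt_add_one h1
      exact lt_of_lt_of_le (ENat.lt_add_one_iff (ne_top_of_le_ne_top (by simp)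
        ((le_self_add.trans h2).trans h3)) |>.2 le_rfl) (h2.trans h3)
    | exact N₁ N₂ N₃ f g hf hg hfg h₁ h₃ =>
      intro h
      exact (chainRank_le_natSum hfg).trans_lt (natSum_lt_omega0_opow
        (h₁ fun q hq => h q (Module.support_subset_of_injective f hf hq))
        (h₃ fun q hq => h q (Module.support_subset_of_surjective g hg hq)))

end Dimension

/-! ### Associated primes and binary modules -/

section Binary

universe w

/-- For every associated prime `p` of `M`, the `p`-power torsion of `M_p` is generated by any
element of annihilator `p`; this says in terms of elements of `M` that this torsion is simple. -/
def LocalTorsionSimple (R : Type u) (M : Type v) [CommRing R] [AddCommGroup M] [Module R M] :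
    Prop :=
  ∀ (p : PrimeSpectrum R) (y z : M) (k : ℕ), (∀ r : R, r • y = 0 ↔ r ∈ p.asIdeal) →
    (∀ r ∈ p.asIdeal ^ k, r • z = 0) → ∃ s ∉ p.asIdeal, s • z ∈ Submodule.span R {y}

variable {R : Type u} {M : Type v} [CommRing R] [AddCommGroup M] [Module R M]

lemma LocalTorsionSimple.submodule (h : LocalTorsionSimple R M) (N : Submodule R M) :
    LocalTorsionSimple R N := by
  intro p y z k hy hz
  obtain ⟨s, hs, hsz⟩ := h p y z k (fun r => by rw [← hy r, ← N.coe_smul, N.coe_eq_zero])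
    fun r hr => by rw [← N.coe_smul, hz r hr, N.coe_zero]
  refine ⟨s, hs, ?_⟩
  obtain ⟨t, ht⟩ := Submodule.mem_span_singleton.1 hsz
  exact Submodule.mem_span_singleton.2 ⟨t, Subtype.ext ht⟩

lemma len_le_of_finLen_le {o : Ordinal.{v}} (h : finLen R M ≤ o)
    (W : Submodule R M) (hW : len R W < ω) : len R W ≤ o := by
  have hbdd : BddAbove {α : Ordinal.{v} | ∃ N : Submodule R M, len R N = α ∧ α < ω} :=
    ⟨ω, fun _ ⟨_, _, hα⟩ => hα.le⟩
  exact (le_csSup hbdd ⟨W, rfl, hW⟩).trans h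

variable (M) in
/-- The submodule of elements killed by a power of the ideal `I`. -/
def powerTorsion (I : Ideal R) : Submodule R M :=
  ⨆ k : ℕ, Submodule.torsionBySet R M (I ^ k : Ideal R)

lemma mem_torsionBySet_pow {I : Ideal R} {k : ℕ} {z : M} :
    z ∈ Submodule.torsionBySet R M (I ^ k : Ideal R) ↔ ∀ r ∈ I ^ k, r • z = 0 := by
  rw [Submodule.mem_torsionBySet_iff]
  exact ⟨fun h r hr => h ⟨r, hr⟩, fun h r => h r r.2⟩

lemma torsionBySet_pow_mono (I : Ideal R) :
    Monotone fun k : ℕ => Submodule.torsionBySet R M (I ^ k : Ideal R) :=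
  fun _ _ hij => Submodule.torsionBySet_le_torsionBySet_of_subset (Ideal.pow_le_pow_right hij)

lemma mem_powerTorsion {I : Ideal R} {z : M} :
    z ∈ powerTorsion M I ↔ ∃ k : ℕ, ∀ r ∈ I ^ k, r • z = 0 := by
  rw [powerTorsion, Submodule.mem_iSup_of_directed _ (torsionBySet_pow_mono I).directed_le]
  simp only [mem_torsionBySet_pow]

lemma exists_pow_smul_powerTorsion [IsNoetherian R M] (I : Ideal R) :
    ∃ k : ℕ, ∀ z ∈ powerTorsion M I, ∀ r ∈ I ^ k, r • z = 0 := by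
  obtain ⟨n, hn⟩ := monotone_stabilizes_iff_noetherian.2 ‹IsNoetherian R M›
    ⟨_, torsionBySet_pow_mono (M := M) I⟩
  refine ⟨n, fun z hz => ?_⟩
  obtain ⟨k, hk⟩ := mem_powerTorsion.1 hz
  rw [← mem_torsionBySet_pow] at hk ⊢
  have h1 := torsionBySet_pow_mono (M := M) I (le_max_right n k) hk
  have h2 : Submodule.torsionBySet R M (I ^ n : Ideal R) =
      Submodule.torsionBySet R M (I ^ max n k : Ideal R) := hn _ (le_max_left n k)
  rwa [h2]

/-- A prime that is the annihilator of an element modulo the `I`-power torsion does not contain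
`I`, so some element outside of it kills that torsion. -/
lemma exists_notMem_smul_powerTorsion [IsNoetherian R M] {I : Ideal R} {q : PrimeSpectrum R}
    {z : M} (hz : ∀ r : R, r • z ∈ powerTorsion M I ↔ r ∈ q.asIdeal) :
    ¬ I ≤ q.asIdeal ∧ ∃ t ∉ q.asIdeal, ∀ w ∈ powerTorsion M I, t • w = 0 := by
  obtain ⟨k, hk⟩ := exists_pow_smul_powerTorsion (M := M) I
  have hI : ¬ I ≤ q.asIdeal := by
    intro hle
    have hzI : z ∈ powerTorsion M I := by
      refine mem_powerTorsion.2 ⟨k + 1, fun r hr => ?_⟩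
      rw [pow_succ] at hr
      induction hr using Submodule.mul_induction_on' with
      | mem_mul_mem a ha b hb => rw [mul_smul, hk _ ((hz b).2 (hle hb)) a ha]
      | add a _ b _ ha hb => rw [add_smul, ha, hb, add_zero]
    exact (Ideal.ne_top_iff_one _).1 q.2.ne_top ((hz 1).1 (by rwa [one_smul]))
  obtain ⟨t, htI, htq⟩ := SetLike.not_le_iff_exists.1 hI
  exact ⟨hI, t ^ k, fun h => htq (q.2.mem_of_pow_mem k h),
    fun w hw => hk w hw _ (Ideal.pow_mem_pow htI k)⟩

lemma smul_quotient_eq_zero_iff {N : Submodule R M} (q : PrimeSpectrum R) {z : M} :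
    (∀ r : R, r • N.mkQ z = 0 ↔ r ∈ q.asIdeal) ↔ ∀ r : R, r • z ∈ N ↔ r ∈ q.asIdeal := by
  refine forall_congr' fun r => ?_
  rw [← map_smul, Submodule.mkQ_apply, Submodule.Quotient.mk_eq_zero]

/-- Multiplication by `t` lifts an element of annihilator `q` modulo the torsion to an element of
`M` of annihilator `q`. -/
lemma annihilator_smul_of_notMem {I : Ideal R} {q : PrimeSpectrum R} {z : M} {t : R}
    (hz : ∀ r : R, r • z ∈ powerTorsion M I ↔ r ∈ q.asIdeal) (htq : t ∉ q.asIdeal)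
    (ht : ∀ w ∈ powerTorsion M I, t • w = 0) (r : R) : r • t • z = 0 ↔ r ∈ q.asIdeal := by
  refine ⟨fun h => ?_, fun h => ?_⟩
  · refine (q.2.mem_or_mem ((hz (r * t)).1 ?_)).resolve_right htq
    rw [mul_smul, h]
    exact zero_mem _
  · rw [smul_comm, ht _ ((hz r).2 h)]

variable [IsNoetherianRing R]

/-- If no multiple of `z` by an element outside `p` lay in `R y`, then the span of `y` and `z` in
`M_p` would have finite length at least `2`, against the bound by the finitistic length. -/
lemma IsBinary.localTorsionSimple [Module.Finite R M] (h : IsBinary R M) :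
    LocalTorsionSimple R M := by
  intro p y z k hy hz
  by_contra! hcon
  let S := p.asIdeal.primeCompl
  let A := Localization.AtPrime p.asIdeal
  let L := LocalizedModule S M
  let ι : M →ₗ[R] L := LocalizedModule.mkLinearMap S M
  have hcoeff : finLen A L ≤ 1 := by
    rcases h p with h | h
    · exact h.le.trans zero_le_one
    · exact h.le
  have : IsNoetherianRing A := IsLocalization.isNoetherianRing S A inferInstance
  have : Module.Finite A L := inferInstance
  let W : Submodule A L := Submodule.span A {ι y, ι z}
  have hyW : ι y ∈ W := Submodule.subset_span (by simp)
  have hzW : ι z ∈ W := Submodule.subset_span (by simp)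
  -- `W` is killed by a power of the maximal ideal, so its length is finite.
  have hkill : ∀ r ∈ p.asIdeal, ∀ w ∈ W, (algebraMap R A r ^ (k + 1)) • w = 0 := by
    intro r hr w hw
    induction hw using Submodule.span_induction with
    | mem w hw =>
      rw [← map_pow, algebraMap_smul]
      rcases hw with rfl | rfl
      · rw [← map_smul, (hy _).2 (Ideal.pow_mem_of_mem _ hr _ k.succ_pos), map_zero]
      · rw [← map_smul, pow_succ', mul_smul, hz _ (Ideal.pow_mem_pow hr k), smul_zero, map_zero]
    | zero => exact smul_zero _
    | add a b _ _ ha hb => rw [smul_add, ha, hb, add_zero]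
    | smul a b _ hb => rw [smul_comm, hb, smul_zero]
  have hfin : len A W < ω := by
    refine len_le_chainRank.trans_lt ?_
    have := chainRank_lt_omega0_opow (R := A) 1 W fun q hq => ?_
    · simpa using this
    · obtain ⟨w, hw⟩ := Module.mem_support_iff_exists_annihilator.1 hq
      have hmax : IsLocalRing.maximalIdeal A ≤ q.asIdeal := by
        rw [← Localization.AtPrime.map_eq_maximalIdeal, Ideal.map_le_iff_le_comap]
        intro r hr
        refine q.2.mem_of_pow_mem (k + 1) (hw ?_)
        rw [Submodule.mem_annihilator_span_singleton]
        exact Subtype.ext (hkill r hr w w.2)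
      have : Order.coheight q = 0 := by
        rw [Order.coheight_eq_zero]
        intro q' hq'
        exact (IsLocalRing.le_maximalIdeal q'.2.ne_top).trans hmax
      rw [this]
      simp
  have hle : len A W ≤ 1 := len_le_of_finLen_le hcoeff W hfin
  let U : Submodule A W := Submodule.span A {⟨ι y, hyW⟩}
  have hU0 : ⊥ < U := by
    rw [bot_lt_iff_ne_bot, Ne, Submodule.span_singleton_eq_bot]
    intro h0
    have h0 : ι y = 0 := congrArg Subtype.val h0
    obtain ⟨s, hs⟩ := (IsLocalizedModule.eq_zero_iff S ι).1 h0
    exact s.2 ((hy _).1 hs)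
  have hU1 : U < ⊤ := by
    rw [lt_top_iff_ne_top]
    intro htop
    have hzU : (⟨ι z, hzW⟩ : W) ∈ U := htop ▸ Submodule.mem_top
    obtain ⟨c, hc⟩ := Submodule.mem_span_singleton.1 hzU
    have hc : c • ι y = ι z := congrArg Subtype.val hc
    obtain ⟨⟨r, s⟩, hrs⟩ := IsLocalization.surj S c
    have h1 : ι (r • y) = ι ((s : R) • z) := by
      rw [map_smul, map_smul, ← hc, ← algebraMap_smul A r, ← algebraMap_smul A (s : R), smul_smul,
        mul_comm, ← hrs]
    obtain ⟨t, ht⟩ := (IsLocalizedModule.eq_iff_exists S ι).1 h1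
    refine hcon (t * s) (S.mul_mem t.2 s.2) (Submodule.mem_span_singleton.2 ⟨t * r, ?_⟩)
    rw [mul_smul, mul_smul]
    exact ht
  have h2 := (((hasChain_one hU1).add (hasChain_one hU0) bot_le le_top).le_len).trans hle
  rw [one_add_one_eq_two] at h2
  exact absurd h2 (by simp)

variable (R M) in
/-- The associated primes of a finitely generated module, as a finite set of points of the
spectrum. -/
noncomputable def assFinset [Module.Finite R M] : Finset (PrimeSpectrum R) :=
  ((associatedPrimes.finite R M).preimage
    (fun _ _ _ _ h => PrimeSpectrum.ext h : Set.InjOn PrimeSpectrum.asIdeal _)).toFinset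

lemma mem_assFinset [Module.Finite R M] {p : PrimeSpectrum R} :
    p ∈ assFinset R M ↔ ∃ m : M, ∀ r : R, r • m = 0 ↔ r ∈ p.asIdeal := by
  rw [assFinset, Set.Finite.mem_toFinset, Set.mem_preimage, AssociatedPrimes.mem_iff,
    isAssociatedPrime_iff]
  simp only [p.2, true_and, SetLike.ext_iff, Submodule.mem_colon_singleton, Submodule.mem_bot]
  exact exists_congr fun m => forall_congr' fun r => Iff.comm

lemma exists_mem_assFinset [Module.Finite R M] {z : M} (hz : z ≠ 0) :
    ∃ p ∈ assFinset R M, ∀ r : R, r • z = 0 → r ∈ p.asIdeal := by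
  obtain ⟨P, hP, hle⟩ := exists_le_isAssociatedPrime_of_isNoetherianRing R z hz
  refine ⟨⟨P, hP.isPrime⟩, ?_, fun r hr => hle ?_⟩
  · rw [assFinset, Set.Finite.mem_toFinset]
    exact hP
  · rwa [Submodule.mem_colon_singleton, Submodule.mem_bot]

lemma assFinset_submodule_subset [Module.Finite R M] (N : Submodule R M) :
    assFinset R N ⊆ assFinset R M := by
  intro p hp
  obtain ⟨m, hm⟩ := mem_assFinset.1 hp
  exact mem_assFinset.2 ⟨m, fun r => by rw [← hm r, ← N.coe_smul, N.coe_eq_zero]⟩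

variable [Module.Finite R M]

lemma mem_assFinset_of_quotient_powerTorsion {I : Ideal R} {q : PrimeSpectrum R}
    (hq : q ∈ assFinset R (M ⧸ powerTorsion M I)) : q ∈ assFinset R M ∧ ¬ I ≤ q.asIdeal := by
  obtain ⟨z, hz⟩ := mem_assFinset.1 hq
  obtain ⟨z, rfl⟩ := Submodule.mkQ_surjective _ z
  rw [smul_quotient_eq_zero_iff] at hz
  obtain ⟨hpq, t, htq, ht⟩ := exists_notMem_smul_powerTorsion hz
  exact ⟨mem_assFinset.2 ⟨t • z, annihilator_smul_of_notMem hz htq ht⟩, hpq⟩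

lemma LocalTorsionSimple.quotient_powerTorsion (h : LocalTorsionSimple R M) (I : Ideal R) :
    LocalTorsionSimple R (M ⧸ powerTorsion M I) := by
  intro q y z k hy hz
  obtain ⟨y, rfl⟩ := Submodule.mkQ_surjective _ y
  obtain ⟨z, rfl⟩ := Submodule.mkQ_surjective _ z
  rw [smul_quotient_eq_zero_iff] at hy
  obtain ⟨-, t, htq, ht⟩ := exists_notMem_smul_powerTorsion hy
  obtain ⟨s, hs, hsz⟩ := h q (t • y) (t • z) k (annihilator_smul_of_notMem hy htq ht)
    fun r hr => by
      have := hz r hr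
      rw [← map_smul, Submodule.mkQ_apply, Submodule.Quotient.mk_eq_zero] at this
      rw [smul_comm, ht _ this]
  refine ⟨s * t, fun hst => (q.2.mem_or_mem hst).elim hs htq, ?_⟩
  obtain ⟨c, hc⟩ := Submodule.mem_span_singleton.1 hsz
  refine Submodule.mem_span_singleton.2 ⟨c * t, ?_⟩
  rw [← map_smul, ← map_smul, mul_smul, mul_smul, hc]

/-- For `p` maximal among the associated primes, every nonzero submodule of the `p`-power torsion
contains an element of annihilator `p`, so it agrees with the torsion at `p`. -/
lemma chainRank_powerTorsion_le (hdim : ∀ p : PrimeSpectrum R, Order.coheight p ≠ ⊤)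
    (hM : LocalTorsionSimple R M) {p : PrimeSpectrum R}
    (hp : ∀ q ∈ assFinset R M, p ≤ q → q = p) :
    chainRank R (powerTorsion M p.asIdeal) ≤ ω ^ (primeDim p : Ordinal.{v}) := by
  refine chainRank_le_of_quotient fun x hx => chainRank_lt_omega0_opow _ _ fun q hq => ?_
  obtain ⟨k, hk⟩ := exists_pow_smul_powerTorsion (M := M) p.asIdeal
  obtain ⟨z, hz⟩ := Module.mem_support_iff_exists_annihilator.1 hq
  obtain ⟨z, rfl⟩ := Submodule.mkQ_surjective _ z
  replace hz : ∀ r : R, r • z ∈ x → r ∈ q.asIdeal := by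
    intro r hr
    refine hz ?_
    rwa [Submodule.mem_annihilator_span_singleton, ← map_smul, Submodule.mkQ_apply,
      Submodule.Quotient.mk_eq_zero]
  have hkz : ∀ w : powerTorsion M p.asIdeal, ∀ r ∈ p.asIdeal ^ k, r • w = 0 :=
    fun w r hr => Subtype.ext (hk w w.2 r hr)
  have hpq : p ≤ q := fun r hr => q.2.mem_of_pow_mem k (hz _ (by
    rw [hkz z _ (Ideal.pow_mem_pow hr k)]
    exact x.zero_mem))
  obtain ⟨w, hwx, hw0⟩ := x.exists_mem_ne_zero_of_ne_bot hx
  obtain ⟨p', hp', -⟩ := exists_mem_assFinset (R := R) (M := x) (z := ⟨w, hwx⟩)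
    fun h => hw0 (congrArg Subtype.val h)
  obtain ⟨y, hy⟩ := mem_assFinset.1 hp'
  have hpp' : p' = p := by
    refine hp p' (assFinset_submodule_subset _ (assFinset_submodule_subset _ hp')) ?_
    intro r hr
    refine p'.2.mem_of_pow_mem k ((hy _).1 (Subtype.ext ?_))
    exact hkz y _ (Ideal.pow_mem_pow hr k)
  subst hpp'
  obtain ⟨s, hs, hsz⟩ := hM.submodule _ p' y z k
    (fun r => by rw [← hy r, ← x.coe_smul, x.coe_eq_zero]) (hkz z)
  have hsq : s ∈ q.asIdeal := hz s ((Submodule.span_singleton_le_iff_mem _ _).2 y.2 hsz)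
  have hlt : p' < q := lt_of_le_of_ne hpq (by rintro rfl; exact hs hsq)
  rw [primeDim, ENat.natCast_toNat (hdim p')]
  exact Order.coheight_strictAnti hlt (lt_top_iff_ne_top.2 (hdim q))

end Binary

section Length

universe w

variable {R : Type u} [CommRing R] [IsNoetherianRing R]

/-- Induction on the number of associated primes: for a maximal one `p`, the `p`-power torsion and
the quotient by it have ranks bounded by the contributions of `p` and of the other primes. -/
lemma chainRank_le_dimCoeff (hdim : ∀ p : PrimeSpectrum R, Order.coheight p ≠ ⊤) (M : Type v)
    [AddCommGroup M] [Module R M] [Module.Finite R M] (hM : LocalTorsionSimple R M) :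
    chainRank R M ≤ ofCoeff (dimCoeff.{u, v} (assFinset R M)) := by
  classical
  induction hn : (assFinset R M).card using Nat.strong_induction_on generalizing M with
  | _ n IH =>
    rcases (assFinset R M).eq_empty_or_nonempty with he | hne
    · have : Subsingleton M := by
        by_contra hns
        rw [not_subsingleton_iff_nontrivial] at hns
        obtain ⟨z, hz⟩ := exists_ne (0 : M)
        obtain ⟨p, hp, -⟩ := exists_mem_assFinset (R := R) hz
        simp [he] at hp
      rw [chainRank_eq_zero]
      exact zero_le
    · obtain ⟨p, hp, hmax⟩ := (assFinset R M).exists_maximal hne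
      let N := powerTorsion M p.asIdeal
      have hsub : assFinset R (M ⧸ N) ⊆ (assFinset R M).erase p := by
        intro q hq
        obtain ⟨h1, h2⟩ := mem_assFinset_of_quotient_powerTorsion hq
        exact Finset.mem_erase.2 ⟨fun h => h2 (h ▸ le_rfl), h1⟩
      have hcard : (assFinset R (M ⧸ N)).card < n :=
        hn ▸ (Finset.card_le_card hsub).trans_lt (Finset.card_erase_lt_of_mem hp)
      have hQ := IH _ hcard (M ⧸ N) (hM.quotient_powerTorsion _) rfl
      have hN := chainRank_powerTorsion_le hdim hM (p := p)
        fun q hq hpq => le_antisymm (hmax hq hpq) hpq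
      calc chainRank R M ≤ natSum (chainRank R N) (chainRank R (M ⧸ N)) :=
            chainRank_le_natSum (LinearMap.exact_subtype_mkQ N)
        _ ≤ natSum (ofCoeff (Finsupp.single (primeDim p : Ordinal) 1))
              (ofCoeff (dimCoeff ((assFinset R M).erase p))) := by
            refine natSum_le_natSum (by simpa using hN) (hQ.trans ?_)
            exact ofCoeff_strictMono.monotone (Finset.sum_le_sum_of_subset hsub)
        _ = ofCoeff (dimCoeff (assFinset R M)) := by
            rw [natSum_ofCoeff, dimCoeff, dimCoeff, Finset.add_sum_erase _
              (fun p => Finsupp.single (primeDim p : Ordinal.{v}) 1) hp]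

variable {M : Type v} [AddCommGroup M] [Module R M] [Module.Finite R M]

/-- The length of a binary module is the natural sum of the `ω ^ dim (R / p)` over its associated
primes. -/
lemma len_eq_dimCoeff (hdim : ∀ p : PrimeSpectrum R, Order.coheight p ≠ ⊤)
    (hM : LocalTorsionSimple R M) :
    len R M = ofCoeff (dimCoeff.{u, v} (assFinset R M)) := by
  refine le_antisymm (len_le_chainRank.trans (chainRank_le_dimCoeff hdim M hM)) ?_
  exact (hasChain_dimCoeff _ _ fun p hp => mem_assFinset.1 hp).le_len

lemma valence_eq_card (hdim : ∀ p : PrimeSpectrum R, Order.coheight p ≠ ⊤)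
    (hM : LocalTorsionSimple R M) : valence R M = (assFinset R M).card := by
  classical
  rw [valence, len_eq_dimCoeff hdim hM, ordinalValence_ofCoeff]
  induction assFinset R M using Finset.induction_on with
  | empty => simp [dimCoeff]
  | insert p S hp IH =>
    rw [Finset.card_insert_of_notMem hp, ← IH, dimCoeff, Finset.sum_insert hp,
      Finsupp.sum_add_index' (by simp) (by simp), Finsupp.sum_single_index rfl, add_comm, dimCoeff]

lemma isOpenSubmodule_iff (hdim : ∀ p : PrimeSpectrum R, Order.coheight p ≠ ⊤)
    (hM : LocalTorsionSimple R M) (N : Submodule R M) :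
    IsOpenSubmodule N ↔ assFinset R M ⊆ assFinset R N := by
  have hsub := assFinset_submodule_subset N
  rw [IsOpenSubmodule, len_eq_dimCoeff hdim hM, len_eq_dimCoeff hdim (hM.submodule N)]
  refine ⟨fun h => ?_, fun h => by rw [hsub.antisymm h]⟩
  by_contra hne
  obtain ⟨p, hp, hpN⟩ := Finset.not_subset.1 hne
  have : dimCoeff.{u, v} (assFinset R N) < dimCoeff (assFinset R M) :=
    Finset.sum_lt_sum_of_subset hsub hp hpN (by simp [pos_iff_ne_zero]) (fun _ _ _ => zero_le)
  exact (ofCoeff_strictMono this).ne h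

end Length

/-! ### Nilpotent endomorphisms -/

section Endomorphisms

variable {R : Type u} {M : Type v} [CommRing R] [AddCommGroup M] [Module R M]

/-- If `M` has simple local torsion, `f` acts on `y` of annihilator `p` by a scalar of the residue
field of `p`. -/
lemma LocalTorsionSimple.exists_smul_apply_eq (hM : LocalTorsionSimple R M)
    {p : PrimeSpectrum R} {y : M} (hy : ∀ r : R, r • y = 0 ↔ r ∈ p.asIdeal)
    (f : Module.End R M) : ∃ s ∉ p.asIdeal, ∃ c : R, s • f y = c • y := by
  obtain ⟨s, hs, h⟩ := hM p y (f y) 1 hy fun r hr => by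
    rw [pow_one] at hr
    rw [← map_smul, (hy r).2 hr, map_zero]
  obtain ⟨c, hc⟩ := Submodule.mem_span_singleton.1 h
  exact ⟨s, hs, c, hc.symm⟩

variable [IsNoetherianRing R] [Module.Finite R M]

variable (R M) in
/-- The endomorphisms of `M` that induce zero on the `p`-power torsion of `M_p`, for every
associated prime `p` of `M`. -/
noncomputable def locallyZeroIdeal : Ideal (Module.End R M) where
  carrier := {f | ∀ p ∈ assFinset R M, ∀ (y : M) (k : ℕ), (∀ r ∈ p.asIdeal ^ k, r • y = 0) →
    ∃ s ∉ p.asIdeal, s • f y = 0}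
  zero_mem' p _ y k _ := ⟨1, (Ideal.ne_top_iff_one _).1 p.2.ne_top, by simp⟩
  add_mem' {f g} hf hg p hp y k hy := by
    obtain ⟨s, hs, hsf⟩ := hf p hp y k hy
    obtain ⟨t, ht, htg⟩ := hg p hp y k hy
    refine ⟨s * t, fun h => (p.2.mem_or_mem h).elim hs ht, ?_⟩
    rw [LinearMap.add_apply, smul_add, mul_smul s t (g y), htg, mul_comm, mul_smul, hsf]
    simp
  smul_mem' g f hf p hp y k hy := by
    obtain ⟨s, hs, hsf⟩ := hf p hp y k hy
    refine ⟨s, hs, ?_⟩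
    rw [smul_eq_mul, Module.End.mul_apply, ← map_smul, hsf, map_zero]

instance : (locallyZeroIdeal R M).IsTwoSided :=
  ⟨fun {f} g hf p hp y k hy => hf p hp (g y) k fun r hr => by rw [← map_smul, hy r hr, map_zero]⟩

/-- To test that `f` vanishes on the `p`-power torsion of `M_p`, one element of annihilator `p`
suffices. -/
lemma LocalTorsionSimple.mem_locallyZeroIdeal_of_forall (hM : LocalTorsionSimple R M)
    {f : Module.End R M} (hf : ∀ p ∈ assFinset R M, ∃ y : M,
      (∀ r : R, r • y = 0 ↔ r ∈ p.asIdeal) ∧ ∃ s ∉ p.asIdeal, s • f y = 0) :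
    f ∈ locallyZeroIdeal R M := by
  intro p hp z k hz
  obtain ⟨y, hy, s, hs, hsf⟩ := hf p hp
  obtain ⟨t, ht, htz⟩ := hM p y z k hy hz
  obtain ⟨c, hc⟩ := Submodule.mem_span_singleton.1 htz
  refine ⟨s * t, fun h => (p.2.mem_or_mem h).elim hs ht, ?_⟩
  rw [mul_smul, ← map_smul, ← hc, map_smul, smul_comm, hsf, smul_zero]

lemma LocalTorsionSimple.commutator_mem_locallyZeroIdeal (hM : LocalTorsionSimple R M)
    (f g : Module.End R M) : f * g - g * f ∈ locallyZeroIdeal R M := by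
  refine hM.mem_locallyZeroIdeal_of_forall fun p hp => ?_
  obtain ⟨y, hy⟩ := mem_assFinset.1 hp
  obtain ⟨s, hs, c, hc⟩ := hM.exists_smul_apply_eq hy f
  obtain ⟨t, ht, d, hd⟩ := hM.exists_smul_apply_eq hy g
  refine ⟨y, hy, s * t, fun h => (p.2.mem_or_mem h).elim hs ht, ?_⟩
  have h1 : (s * t) • f (g y) = (c * d) • y := by
    rw [mul_smul, ← map_smul, hd, map_smul, smul_comm, hc, smul_smul, mul_comm]
  have h2 : (s * t) • g (f y) = (c * d) • y := by
    rw [mul_comm, mul_smul, ← map_smul, hc, map_smul, smul_comm, hd, smul_smul]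
  rw [LinearMap.sub_apply, Module.End.mul_apply, Module.End.mul_apply, smul_sub, h1, h2, sub_self]

lemma LocalTorsionSimple.mem_locallyZeroIdeal_of_isNilpotent (hM : LocalTorsionSimple R M)
    {f : Module.End R M} (hf : IsNilpotent f) : f ∈ locallyZeroIdeal R M := by
  obtain ⟨n, hn⟩ := hf
  refine hM.mem_locallyZeroIdeal_of_forall fun p hp => ?_
  obtain ⟨y, hy⟩ := mem_assFinset.1 hp
  obtain ⟨s, hs, c, hc⟩ := hM.exists_smul_apply_eq hy f
  refine ⟨y, hy, s, hs, ?_⟩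
  have hpow : ∀ m : ℕ, s ^ m • (f ^ m) y = c ^ m • y := by
    intro m
    induction m with
    | zero => simp
    | succ m IH =>
      rw [pow_succ f, Module.End.mul_apply, pow_succ s, mul_smul, ← map_smul, hc, map_smul,
        smul_comm, IH, smul_smul, pow_succ']
  have h := hpow n
  rw [hn, LinearMap.zero_apply, smul_zero] at h
  rw [hc]
  exact (hy c).2 (p.2.mem_of_pow_mem n ((hy _).1 h.symm))

lemma LocalTorsionSimple.mem_locallyZeroIdeal_iff_isOpenSubmodule
    (hdim : ∀ p : PrimeSpectrum R, Order.coheight p ≠ ⊤) (hM : LocalTorsionSimple R M)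
    {f : Module.End R M} :
    f ∈ locallyZeroIdeal R M ↔ IsOpenSubmodule (LinearMap.ker f) := by
  rw [isOpenSubmodule_iff hdim hM]
  refine ⟨fun hf p hp => ?_, fun h => hM.mem_locallyZeroIdeal_of_forall fun p hp => ?_⟩
  · obtain ⟨y, hy⟩ := mem_assFinset.1 hp
    obtain ⟨s, hs, hsf⟩ := hf p hp y 1 fun r hr => (hy r).2 (by rwa [pow_one] at hr)
    refine mem_assFinset.2 ⟨⟨s • y, by rw [LinearMap.mem_ker, map_smul, hsf]⟩, fun r => ?_⟩
    rw [← Submodule.coe_eq_zero, Submodule.coe_smul, smul_smul, hy]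
    exact ⟨fun h => (p.2.mem_or_mem h).resolve_right hs, fun h => Ideal.mul_mem_right _ _ h⟩
  · obtain ⟨y, hy⟩ := mem_assFinset.1 (h hp)
    refine ⟨y, fun r => ?_, 1, (Ideal.ne_top_iff_one _).1 p.2.ne_top, ?_⟩
    · rw [← hy r, ← Submodule.coe_smul, Submodule.coe_eq_zero]
    · rw [LinearMap.mem_ker.1 y.2, smul_zero]

/-- At a minimal associated prime `p`, the localization `M_p` is `p`-power torsion. -/
lemma exists_smul_powerTorsion_of_minimal {p : PrimeSpectrum R}
    (hp : ∀ q ∈ assFinset R M, q ≤ p → q = p) (z : M) :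
    ∃ s ∉ p.asIdeal, ∃ k : ℕ, ∀ r ∈ p.asIdeal ^ k, r • s • z = 0 := by
  -- Choose `s` with the annihilator of `s • z` maximal, so that it is saturated at `p`.
  obtain ⟨J, ⟨s, hs, rfl⟩, hmax⟩ := set_has_maximal_iff_noetherian.2 ‹IsNoetherianRing R›
    {J : Ideal R | ∃ s ∉ p.asIdeal, J = (Submodule.span R {s • z}).annihilator}
    ⟨_, 1, (Ideal.ne_top_iff_one _).1 p.2.ne_top, rfl⟩
  have hsat : ∀ t ∉ p.asIdeal, ∀ r : R, r • t • s • z = 0 → r • s • z = 0 := by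
    intro t ht r hr
    have hle : (Submodule.span R {s • z}).annihilator ≤
        (Submodule.span R {(t * s) • z}).annihilator := by
      intro r hr
      rw [Submodule.mem_annihilator_span_singleton] at hr ⊢
      rw [mul_smul, smul_comm, hr, smul_zero]
    have heq := hle.eq_of_not_lt
      (hmax _ ⟨t * s, fun h => (p.2.mem_or_mem h).elim ht hs, rfl⟩)
    rw [← Submodule.mem_annihilator_span_singleton, heq,
      Submodule.mem_annihilator_span_singleton, mul_smul, hr]
  have hrad : p.asIdeal ≤ (Submodule.span R {s • z}).annihilator.radical := by
    rw [← Ideal.sInf_minimalPrimes]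
    refine le_sInf fun P hP => ?_
    let q : PrimeSpectrum R := ⟨P, hP.isPrime⟩
    have hass : q ∈ assFinset R (Submodule.span R {s • z}) := by
      rw [assFinset, Set.Finite.mem_toFinset]
      exact Module.associatedPrimes.minimalPrimes_annihilator_subset_associatedPrimes R _ hP
    have hqp : q ≤ p := by
      intro t ht
      by_contra htp
      obtain ⟨⟨m, hm⟩, hmq⟩ := mem_assFinset.1 hass
      obtain ⟨r, rfl⟩ := Submodule.mem_span_singleton.1 hm
      refine (Ideal.ne_top_iff_one _).1 q.2.ne_top ((hmq 1).1 (Subtype.ext ?_))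
      have h0 : t • r • s • z = 0 := congrArg Subtype.val ((hmq t).2 ht)
      rw [smul_comm] at h0
      simpa using hsat t htp r h0
    rw [← hp q (assFinset_submodule_subset _ hass) hqp]
  obtain ⟨k, hk⟩ := Ideal.exists_pow_le_of_le_radical_of_fg hrad p.asIdeal.fg_of_isNoetherianRing
  exact ⟨s, hs, k, fun r hr => (Submodule.mem_annihilator_span_singleton _ _).1 (hk hr)⟩

/-- The submodule spanned by the images of `N` under the locally zero endomorphisms of `M`. -/
def locallyZeroImage (N : Submodule R M) : Submodule R M :=
  Submodule.span R {w | ∃ f ∈ locallyZeroIdeal R M, ∃ z ∈ N, f z = w}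

lemma locallyZeroImage_mono : Monotone (locallyZeroImage (R := R) (M := M)) :=
  fun _ _ h => Submodule.span_mono fun _ ⟨f, hf, z, hz, hw⟩ => ⟨f, hf, z, h hz, hw⟩

/-- The minimal associated primes of `N` are not associated to its locally zero image. -/
lemma notMem_assFinset_locallyZeroImage {N : Submodule R M} {p : PrimeSpectrum R}
    (hp : p ∈ assFinset R N) (hmin : ∀ q ∈ assFinset R N, q ≤ p → q = p) :
    p ∉ assFinset R (locallyZeroImage N) := by
  intro hmem
  obtain ⟨⟨w, hw⟩, hwp⟩ := mem_assFinset.1 hmem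
  have key : ∃ s ∉ p.asIdeal, s • w = 0 := by
    clear hwp
    induction hw using Submodule.span_induction with
    | mem w hw =>
      obtain ⟨f, hf, z, hz, rfl⟩ := hw
      obtain ⟨s, hs, k, hk⟩ := exists_smul_powerTorsion_of_minimal hmin ⟨z, hz⟩
      obtain ⟨t, ht, h⟩ := hf p (assFinset_submodule_subset _ hp) (s • z) k
        fun r hr => congrArg Subtype.val (hk r hr)
      refine ⟨t * s, fun h => (p.2.mem_or_mem h).elim ht hs, ?_⟩
      rwa [mul_smul, ← map_smul]
    | zero => exact ⟨1, (Ideal.ne_top_iff_one _).1 p.2.ne_top, smul_zero _⟩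
    | add a b _ _ ha hb =>
      obtain ⟨s, hs, hsa⟩ := ha
      obtain ⟨t, ht, htb⟩ := hb
      refine ⟨s * t, fun h => (p.2.mem_or_mem h).elim hs ht, ?_⟩
      rw [smul_add, mul_smul s t b, htb, mul_comm, mul_smul, hsa]
      simp
    | smul c a _ ha =>
      obtain ⟨s, hs, hsa⟩ := ha
      exact ⟨s, hs, by rw [smul_comm, hsa, smul_zero]⟩
  obtain ⟨s, hs, hsw⟩ := key
  exact hs ((hwp s).1 (Subtype.ext hsw))

/-- Each step removes the minimal associated primes, so there are at most as many steps as
associated primes of `M`. -/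
lemma iterate_locallyZeroImage_eq_bot :
    locallyZeroImage^[(assFinset R M).card] (⊤ : Submodule R M) = ⊥ := by
  have hanti : ∀ n, locallyZeroImage^[n + 1] (⊤ : Submodule R M) ≤
      locallyZeroImage^[n] (⊤ : Submodule R M) := by
    intro n
    rw [Function.iterate_succ_apply]
    exact locallyZeroImage_mono.iterate n le_top
  have hbot : ∀ N : Submodule R M, assFinset R N = ∅ → N = ⊥ := by
    intro N hN
    rw [Submodule.eq_bot_iff]
    intro z hz
    by_contra hz0
    obtain ⟨p, hp, -⟩ := exists_mem_assFinset (R := R) (M := N) (z := ⟨z, hz⟩)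
      fun h => hz0 (congrArg Subtype.val h)
    simp [hN] at hp
  have hcard : ∀ n, n ≤ (assFinset R M).card →
      (assFinset R (locallyZeroImage^[n] (⊤ : Submodule R M))).card + n ≤
        (assFinset R M).card := by
    intro n
    induction n with
    | zero => exact fun _ => Finset.card_le_card (assFinset_submodule_subset _)
    | succ n IH =>
      intro hn
      have IH := IH (n.le_succ.trans hn)
      set N := locallyZeroImage^[n] (⊤ : Submodule R M) with hNdef
      have hle : locallyZeroImage N ≤ N := by
        have := hanti n
        rwa [Function.iterate_succ_apply'] at this
      have hsub : assFinset R (locallyZeroImage N) ⊆ assFinset R N := by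
        intro q hq
        obtain ⟨⟨w, hw⟩, hwq⟩ := mem_assFinset.1 hq
        refine mem_assFinset.2 ⟨⟨w, hle hw⟩, fun r => ?_⟩
        rw [← hwq r, Subtype.ext_iff, Subtype.ext_iff]
        rfl
      rw [Function.iterate_succ_apply', ← hNdef]
      rcases (assFinset R N).eq_empty_or_nonempty with he | hne
      · rw [he, Finset.subset_empty] at hsub
        rw [hsub, Finset.card_empty]
        omega
      · obtain ⟨p, hp, hmin⟩ := (assFinset R N).exists_minimal hne
        have hlt := Finset.card_lt_card (Finset.ssubset_iff_subset_ne.2 ⟨hsub, fun he =>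
          notMem_assFinset_locallyZeroImage hp (fun q hq hqp => le_antisymm hqp (hmin hq hqp))
            (he ▸ hp)⟩)
        omega
  have := hcard _ le_rfl
  exact hbot _ (Finset.card_eq_zero.1 (by omega))

lemma apply_mem_iterate_locallyZeroImage {f : Module.End R M} (hf : f ∈ locallyZeroIdeal R M)
    {n : ℕ} {z : M} (hz : z ∈ locallyZeroImage^[n] (⊤ : Submodule R M)) :
    f z ∈ locallyZeroImage^[n + 1] (⊤ : Submodule R M) := by
  rw [Function.iterate_succ_apply']
  exact Submodule.subset_span ⟨f, hf, z, hz, rfl⟩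

lemma pow_card_eq_zero_of_mem_locallyZeroIdeal {f : Module.End R M}
    (hf : f ∈ locallyZeroIdeal R M) : f ^ (assFinset R M).card = 0 := by
  have h : ∀ (n : ℕ) (z : M), (f ^ n) z ∈ locallyZeroImage^[n] (⊤ : Submodule R M) := by
    intro n
    induction n with
    | zero => simp
    | succ n IH =>
      intro z
      rw [pow_succ', Module.End.mul_apply]
      exact apply_mem_iterate_locallyZeroImage hf (IH z)
  ext z
  have := h (assFinset R M).card z
  rwa [iterate_locallyZeroImage_eq_bot, Submodule.mem_bot] at this

lemma isNilpotent_locallyZeroIdeal : IsNilpotent (locallyZeroIdeal R M) := by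
  have h : ∀ (n : ℕ), ∀ f ∈ locallyZeroIdeal R M ^ n, ∀ z : M,
      f z ∈ locallyZeroImage^[n] (⊤ : Submodule R M) := by
    intro n
    induction n with
    | zero => simp
    | succ n IH =>
      intro f hf z
      rw [Ideal.IsTwoSided.pow_succ] at hf
      induction hf using Submodule.smul_induction_on' with
      | smul a ha b hb => exact apply_mem_iterate_locallyZeroImage ha (IH b hb z)
      | add a _ b _ ha hb => exact Submodule.add_mem _ ha hb
  refine ⟨(assFinset R M).card, ?_⟩
  rw [Ideal.zero_eq_bot, eq_bot_iff]
  intro f hf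
  rw [Ideal.mem_bot]
  ext z
  have := h _ f hf z
  rwa [iterate_locallyZeroImage_eq_bot, Submodule.mem_bot] at this

lemma LocalTorsionSimple.isNilpotent_iff_mem_locallyZeroIdeal (hM : LocalTorsionSimple R M)
    {f : Module.End R M} : IsNilpotent f ↔ f ∈ locallyZeroIdeal R M :=
  ⟨hM.mem_locallyZeroIdeal_of_isNilpotent, fun hf =>
    ⟨_, pow_card_eq_zero_of_mem_locallyZeroIdeal hf⟩⟩

end Endomorphisms

lemma coheight_ne_top_of_ringKrullDim_lt_top {R : Type u} [CommRing R]
    (h : ringKrullDim R < ⊤) (p : PrimeSpectrum R) : Order.coheight p ≠ ⊤ := by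
  intro htop
  have := (Order.coheight_le_krullDim p).trans_lt h
  rw [htop] at this
  exact this.ne rfl

end OrdinalLength

theorem theoremT {R : Type u} {M : Type v} [CommRing R] [IsNoetherianRing R]
    (hdim : ringKrullDim R < ⊤) [AddCommGroup M] [Module R M] [Module.Finite R M]
    (hM : OrdinalLength.IsBinary R M) (v : ℕ) (hv : OrdinalLength.valence R M = v) :
    (∀ f : Module.End R M,
      (IsNilpotent f ↔ OrdinalLength.IsOpenSubmodule (LinearMap.ker f)) ∧
      (IsNilpotent f ↔ f ^ v = 0)) ∧
    ∃ (𝔑 : Ideal (Module.End R M)) (_ : 𝔑.IsTwoSided),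
      (∀ f : Module.End R M, f ∈ 𝔑 ↔ IsNilpotent f) ∧
      (IsAddTorsionFree M → IsNilpotent 𝔑) ∧
      (∀ x y : Module.End R M ⧸ 𝔑, x * y = y * x) := by
  have hdim' := OrdinalLength.coheight_ne_top_of_ringKrullDim_lt_top hdim
  have hS := hM.localTorsionSimple
  rw [OrdinalLength.valence_eq_card hdim' hS] at hv
  refine ⟨fun f => ⟨?_, ?_⟩, OrdinalLength.locallyZeroIdeal R M, inferInstance,
    fun f => hS.isNilpotent_iff_mem_locallyZeroIdeal.symm, fun _ =>
      OrdinalLength.isNilpotent_locallyZeroIdeal, ?_⟩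
  · rw [hS.isNilpotent_iff_mem_locallyZeroIdeal,
      hS.mem_locallyZeroIdeal_iff_isOpenSubmodule hdim']
  · refine ⟨fun h => ?_, fun h => ⟨v, h⟩⟩
    rw [← hv]
    exact OrdinalLength.pow_card_eq_zero_of_mem_locallyZeroIdeal
      (hS.isNilpotent_iff_mem_locallyZeroIdeal.1 h)
  · intro x y
    obtain ⟨f, rfl⟩ := Ideal.Quotient.mk_surjective x
    obtain ⟨g, rfl⟩ := Ideal.Quotient.mk_surjective y
    rw [← map_mul, ← map_mul, Ideal.Quotient.eq]
    exact hS.commutator_mem_locallyZeroIdeal f g
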